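/- Let $M$ be a set, $\mathfrak{A}(M)$ a $\sigma$-algebra of subsets of $M$, $\mathcal{I}$ a $\sigma$-ideal in $\mathfrak{A}(M)$, and let $\mathfrak{A} = \mathfrak{A}(M)/\mathcal{I}$ be the quotient Boolean algebra, where $[A] = [B]$ if and only if $A \mathbin{\Delta} B \in \mathcal{I}$. A bounded spectral family in $\mathfrak{A}$ is a map $E : \mathbb{R} \to \mathfrak{A}$, $\lambda \mapsto E_\lambda$, such that $E_\lambda \le E_\mu$ for $\lambda \le \mu$, $E_\lambda = \bigwedge_{\mu > \lambda} E_\mu$ for all $\lambda \in \mathbb{R}$, $\bigwedge_{\lambda} E_\lambda = 0$, $\bigvee_{\lambda} E_\lambda = 1$, and there are $a, b \in \mathbb{R}$ with $E_\lambda = 0$ for $\lambda < a$ and $E_\lambda = 1$ for $\lambda \ge b$. Let $\mathcal{F}_{\mathfrak{A}(M)}(M, \mathbb{R})$ be the algebra of all bounded $\mathfrak{A}(M)$-measurable functions $M \to \mathbb{R}$, and let $\mathcal{F}_{\mathbb{R}}(\mathcal{I})$ be the ideal of those that vanish outside some $A \in \mathcal{I}$. For $\varphi \in \mathcal{F}_{\mathfrak{A}(M)}(M,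 \mathbb{R})$ put $E^{\varphi}_{\lambda} = \varphi^{-1}(]-\infty, \lambda])$. Let $E$ be a bounded spectral family in $\mathfrak{A}$. Then there is some $\varphi \in \mathcal{F}_{\mathfrak{A}(M)}(M, \mathbb{R})$ such that \[ E_\lambda = [E^{\varphi}_{\lambda}] \quad \text{for all } \lambda \in \mathbb{R}. \] This $\varphi$ is unique up to equivalence modulo $\mathcal{F}_{\mathbb{R}}(\mathcal{I})$: a function $\psi \in \mathcal{F}_{\mathfrak{A}(M)}(M, \mathbb{R})$ satisfies $E_\lambda = [E^{\psi}_{\lambda}]$ for all $\lambda \in \mathbb{R}$ if and only if $\psi - \varphi \in \mathcal{F}_{\mathbb{R}}(\mathcal{I})$. -/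

import Mathlib

/-! ## The quotient of a Boolean algebra by an ideal -/

section Quotient

variable {B : Type*} [BooleanAlgebra B]

/-- Two elements are equivalent modulo the ideal `I` if their symmetric difference is in `I`. -/
def idealSetoid (I : Order.Ideal B) : Setoid B where
  r a b := symmDiff a b ∈ I
  iseqv :=
    { refl := fun a => by simp
      symm := fun {a b} h => by rwa [symmDiff_comm]
      trans := fun {a b c} hab hbc =>
        I.lower (symmDiff_triangle a b c) (I.sup_mem hab hbc) }

/-- The quotient `B / I` of a Boolean algebra by an ideal. -/
def BoolQuot (I : Order.Ideal B) : Type _ := Quotient (idealSetoid I)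

namespace BoolQuot

variable {I : Order.Ideal B}

/-- The equivalence class `[a]` of `a` modulo `I`. -/
def mk (I : Order.Ideal B) (a : B) : BoolQuot I := Quotient.mk (idealSetoid I) a

theorem mk_eq_mk {a b : B} : mk I a = mk I b ↔ symmDiff a b ∈ I :=
  Quotient.eq (r := idealSetoid I)

theorem sdiff_mem_of_mem {a b c d : B} (hac : symmDiff a c ∈ I) (hbd : symmDiff b d ∈ I)
    (h : a \ b ∈ I) : c \ d ∈ I := by
  refine I.lower ?_ (I.sup_mem (I.sup_mem hac hbd) h)
  calc c \ d ≤ c \ a ⊔ a \ d := sdiff_triangle c a d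
    _ ≤ c \ a ⊔ (a \ b ⊔ b \ d) := sup_le_sup_left (sdiff_triangle a b d) _
    _ ≤ symmDiff a c ⊔ symmDiff b d ⊔ a \ b := by
      refine sup_le ?_ (sup_le le_sup_right ?_)
      · exact le_sup_of_le_left (le_sup_of_le_left le_sup_right)
      · exact le_sup_of_le_left (le_sup_of_le_right le_sup_left)

/-- `[a] ≤ [b]` if `a \ b ∈ I`. -/
instance : LE (BoolQuot I) where
  le := Quotient.lift₂ (fun a b => a \ b ∈ I) (fun _ _ _ _ hac hbd => propext
    ⟨sdiff_mem_of_mem hac hbd,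
     sdiff_mem_of_mem (by rw [symmDiff_comm]; exact hac) (by rw [symmDiff_comm]; exact hbd)⟩)

theorem mk_le_mk {a b : B} : mk I a ≤ mk I b ↔ a \ b ∈ I := Iff.rfl

instance : PartialOrder (BoolQuot I) where
  le_refl := by
    rintro ⟨a⟩
    exact mk_le_mk.2 (by simp)
  le_trans := by
    rintro ⟨a⟩ ⟨b⟩ ⟨c⟩ hab hbc
    exact mk_le_mk.2 (I.lower (sdiff_triangle a b c)
      (I.sup_mem (mk_le_mk.1 hab) (mk_le_mk.1 hbc)))
  le_antisymm := by
    rintro ⟨a⟩ ⟨b⟩ hab hba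
    exact mk_eq_mk.2 (I.sup_mem (mk_le_mk.1 hab) (mk_le_mk.1 hba))

theorem mk_mono {a b : B} (h : a ≤ b) : mk I a ≤ mk I b :=
  mk_le_mk.2 (by rw [sdiff_eq_bot_iff.2 h]; exact I.bot_mem)

theorem mk_sup_le {a b c : B} (h1 : mk I a ≤ mk I c) (h2 : mk I b ≤ mk I c) :
    mk I (a ⊔ b) ≤ mk I c :=
  mk_le_mk.2 (by rw [sup_sdiff]; exact I.sup_mem h1 h2)

theorem le_mk_inf {a b c : B} (h1 : mk I a ≤ mk I b) (h2 : mk I a ≤ mk I c) :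
    mk I a ≤ mk I (b ⊓ c) :=
  mk_le_mk.2 (by rw [sdiff_inf]; exact I.sup_mem h1 h2)

theorem mk_compl_le {a b : B} (h : mk I a ≤ mk I b) : mk I bᶜ ≤ mk I aᶜ :=
  mk_le_mk.2 (by rw [compl_sdiff_compl]; exact h)

/-- The Boolean operations of `B / I` are induced by those of `B`. -/
instance : BooleanAlgebra (BoolQuot I) where
  sup := Quotient.map₂ (· ⊔ ·) (fun a c hac b d hbd => by
    refine mk_eq_mk.1 (le_antisymm (mk_sup_le ?_ ?_) (mk_sup_le ?_ ?_))
    · exact (mk_eq_mk.2 hac).le.trans (mk_mono le_sup_left)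
    · exact (mk_eq_mk.2 hbd).le.trans (mk_mono le_sup_right)
    · exact (mk_eq_mk.2 hac).ge.trans (mk_mono le_sup_left)
    · exact (mk_eq_mk.2 hbd).ge.trans (mk_mono le_sup_right))
  inf := Quotient.map₂ (· ⊓ ·) (fun a c hac b d hbd => by
    refine mk_eq_mk.1 (le_antisymm (le_mk_inf ?_ ?_) (le_mk_inf ?_ ?_))
    · exact (mk_mono inf_le_left).trans (mk_eq_mk.2 hac).le
    · exact (mk_mono inf_le_right).trans (mk_eq_mk.2 hbd).le
    · exact (mk_mono inf_le_left).trans (mk_eq_mk.2 hac).ge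
    · exact (mk_mono inf_le_right).trans (mk_eq_mk.2 hbd).ge)
  compl := Quotient.map (·ᶜ) (fun a b hab =>
    mk_eq_mk.1 (le_antisymm (mk_compl_le (mk_eq_mk.2 hab).ge) (mk_compl_le (mk_eq_mk.2 hab).le)))
  top := mk I ⊤
  bot := mk I ⊥
  le_sup_left := by rintro ⟨a⟩ ⟨b⟩; exact mk_mono le_sup_left
  le_sup_right := by rintro ⟨a⟩ ⟨b⟩; exact mk_mono le_sup_right
  sup_le := by rintro ⟨a⟩ ⟨b⟩ ⟨c⟩ h1 h2; exact mk_sup_le h1 h2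
  inf_le_left := by rintro ⟨a⟩ ⟨b⟩; exact mk_mono inf_le_left
  inf_le_right := by rintro ⟨a⟩ ⟨b⟩; exact mk_mono inf_le_right
  le_inf := by rintro ⟨a⟩ ⟨b⟩ ⟨c⟩ h1 h2; exact le_mk_inf h1 h2
  le_sup_inf := by rintro ⟨a⟩ ⟨b⟩ ⟨c⟩; exact mk_mono le_sup_inf
  inf_compl_le_bot := by rintro ⟨a⟩; exact mk_mono (inf_compl_self a).le
  top_le_sup_compl := by rintro ⟨a⟩; exact mk_mono (sup_compl_eq_top).ge
  le_top := by rintro ⟨a⟩; exact mk_mono le_top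
  bot_le := by rintro ⟨a⟩; exact mk_mono bot_le

end BoolQuot

end Quotient

/-! ## Spectral families -/

/-- A spectral family in a bounded lattice `L`. All the infima and suprema that occur are required
to exist; for an increasing family they are infima and suprema over the countable set of rational
indices. -/
structure IsSpectralFamily {L : Type*} [Lattice L] [BoundedOrder L] (E : ℝ → L) : Prop where
  mono : ∀ s t : ℝ, s ≤ t → E s ≤ E t
  isGLB_Ioi : ∀ t : ℝ, IsGLB (E '' Set.Ioi t) (E t)
  isGLB_range : IsGLB (Set.range E) ⊥
  isLUB_range : IsLUB (Set.range E) ⊤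

/-- A spectral family is bounded if it is `0` far to the left and `1` far to the right. -/
def IsBoundedSpectralFamily {L : Type*} [Lattice L] [BoundedOrder L] (E : ℝ → L) : Prop :=
  IsSpectralFamily E ∧ ∃ a b : ℝ, (∀ t < a, E t = ⊥) ∧ (∀ t ≥ b, E t = ⊤)

/-! ## Measurable functions -/

section Measurable

variable {M : Type*} [MeasurableSpace M]

/-- The σ-algebra `𝔄(M)` of subsets of `M`, as a Boolean algebra. -/
abbrev MeasSets (M : Type*) [MeasurableSpace M] : Type _ := {s : Set M // MeasurableSet s}

/-- An ideal in `𝔄(M)` is a σ-ideal if it is closed under countable unions. -/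
def IsSigmaIdeal (I : Order.Ideal (MeasSets M)) : Prop :=
  ∀ A : ℕ → MeasSets M, (∀ n, A n ∈ I) →
    (⟨⋃ n, (A n : Set M), MeasurableSet.iUnion fun n => (A n).2⟩ : MeasSets M) ∈ I

/-- The algebra `𝓕_{𝔄(M)}(M, ℝ)` of bounded measurable functions `M → ℝ`. -/
def boundedMeasurable (M : Type*) [MeasurableSpace M] : Subalgebra ℝ (M → ℝ) where
  carrier := {f | Measurable f ∧ ∃ C : ℝ, ∀ x, |f x| ≤ C}
  mul_mem' := by
    rintro f g ⟨hf, C, hC⟩ ⟨hg, D, hD⟩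
    refine ⟨hf.mul hg, C * D, fun x => ?_⟩
    rw [Pi.mul_apply, abs_mul]
    exact mul_le_mul (hC x) (hD x) (abs_nonneg _) ((abs_nonneg _).trans (hC x))
  add_mem' := by
    rintro f g ⟨hf, C, hC⟩ ⟨hg, D, hD⟩
    exact ⟨hf.add hg, C + D, fun x => (abs_add_le _ _).trans (add_le_add (hC x) (hD x))⟩
  algebraMap_mem' := fun r => ⟨measurable_const, |r|, fun _ => le_rfl⟩

/-- The ideal `𝓕_ℝ(I)` of those bounded measurable real functions that vanish outside some
`A ∈ I`. -/
def vanishingIdeal (I : Order.Ideal (MeasSets M)) : Ideal (boundedMeasurable M) where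
  carrier := {f | ∃ A ∈ I, ∀ x ∉ (A : Set M), (f : M → ℝ) x = 0}
  zero_mem' := ⟨⊥, I.bot_mem, fun _ _ => rfl⟩
  add_mem' := by
    rintro f g ⟨A, hA, hf⟩ ⟨B, hB, hg⟩
    refine ⟨A ⊔ B, I.sup_mem hA hB, fun x hx => ?_⟩
    have h1 : x ∉ (A : Set M) := fun h => hx (Or.inl h)
    have h2 : x ∉ (B : Set M) := fun h => hx (Or.inr h)
    change (f : M → ℝ) x + (g : M → ℝ) x = 0
    rw [hf x h1, hg x h2, add_zero]
  smul_mem' := by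
    rintro c f ⟨A, hA, hf⟩
    refine ⟨A, hA, fun x hx => ?_⟩
    change (c : M → ℝ) x * (f : M → ℝ) x = 0
    rw [hf x hx, mul_zero]

/-- The spectral family `E^φ_t = φ⁻¹(]-∞, t])` in `𝔄(M)` of a bounded measurable function `φ`. -/
def specFamily (φ : boundedMeasurable M) (t : ℝ) : MeasSets M :=
  ⟨(φ : M → ℝ) ⁻¹' Set.Iic t, φ.2.1 measurableSet_Iic⟩

end Measurable

/-! Since ℚ is countable, a σ-ideal absorbs the errors made at all rational levels together. Choose
a representative `F q` of each `E q` and set `φ x = inf {q | x ∈ F q}`; the sets `F q` need not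
increase with `q`. Up to a member of `I`, a representative of `E t` lies in `{φ ≤ t}`, and `{φ ≤ t}`
lies in a representative of each `E u` with `u > t`. Right continuity of `E` then gives equality.
Uniqueness holds because distinct reals are separated by a rational. -/

section Representation

variable {M : Type*} [MeasurableSpace M] {I : Order.Ideal (MeasSets M)}

/-- A measurable set covered by countably many members of a σ-ideal belongs to the σ-ideal. -/
theorem IsSigmaIdeal.mem_of_subset_iUnion (hI : IsSigmaIdeal I) {ι : Type*} [Countable ι]
    [Nonempty ι] {A : ι → MeasSets M} (hA : ∀ i, A i ∈ I) {S : MeasSets M}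
    (hS : (S : Set M) ⊆ ⋃ i, (A i : Set M)) : S ∈ I := by
  obtain ⟨e, he⟩ := exists_surjective_nat ι
  refine I.lower ?_ (hI (fun n => A (e n)) fun n => hA (e n))
  intro x hx
  obtain ⟨i, hi⟩ := Set.mem_iUnion.1 (hS hx)
  obtain ⟨n, rfl⟩ := he i
  exact Set.mem_iUnion.2 ⟨n, hi⟩

/-- Two bounded measurable functions have the same spectral family modulo a σ-ideal if and only if
they agree outside a member of the σ-ideal. -/
theorem mk_specFamily_eq_iff (hI : IsSigmaIdeal I) (φ ψ : boundedMeasurable M) :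
    (∀ t, BoolQuot.mk I (specFamily φ t) = BoolQuot.mk I (specFamily ψ t)) ↔
      ψ - φ ∈ vanishingIdeal I := by
  constructor
  · intro h
    have hmem : ∀ q : ℚ, symmDiff (specFamily φ q) (specFamily ψ q) ∈ I := fun q =>
      BoolQuot.mk_eq_mk.1 (h q)
    refine ⟨⟨⋃ q : ℚ, (symmDiff (specFamily φ q) (specFamily ψ q) : MeasSets M),
      MeasurableSet.iUnion fun q => Subtype.prop _⟩,
      hI.mem_of_subset_iUnion hmem subset_rfl, fun x hx => ?_⟩
    change (ψ : M → ℝ) x - (φ : M → ℝ) x = 0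
    by_contra hne
    apply hx
    rcases lt_or_gt_of_ne (sub_ne_zero.1 hne) with hlt | hlt
    · obtain ⟨q, hq1, hq2⟩ := exists_rat_btwn hlt
      exact Set.mem_iUnion.2 ⟨q, Or.inr ⟨hq1.le, not_le.2 hq2⟩⟩
    · obtain ⟨q, hq1, hq2⟩ := exists_rat_btwn hlt
      exact Set.mem_iUnion.2 ⟨q, Or.inl ⟨hq1.le, not_le.2 hq2⟩⟩
  · rintro ⟨A, hA, h⟩ t
    refine BoolQuot.mk_eq_mk.2 (I.lower ?_ hA)
    intro x hx
    by_contra hxA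
    have heq : (ψ : M → ℝ) x = (φ : M → ℝ) x := sub_eq_zero.1 (h x hxA)
    rcases hx with ⟨h1, h2⟩ | ⟨h1, h2⟩
    · exact h2 (show (ψ : M → ℝ) x ≤ t from heq.le.trans h1)
    · exact h2 (show (φ : M → ℝ) x ≤ t from heq.ge.trans h1)

/-- A bounded spectral family has representatives at the rational indices that are empty far to the
left and everything far to the right. -/
theorem IsBoundedSpectralFamily.exists_representatives {E : ℝ → BoolQuot I}
    (hE : IsBoundedSpectralFamily E) :
    ∃ (F : ℚ → MeasSets M) (a b : ℝ), (∀ q, BoolQuot.mk I (F q) = E q) ∧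
      (∀ q : ℚ, ∀ x ∈ (F q : Set M), a ≤ q) ∧ ∀ q : ℚ, b ≤ q → ∀ x, x ∈ (F q : Set M) := by
  classical
  obtain ⟨-, a, b, ha, hb⟩ := hE
  have hrep : ∀ q : ℚ, ∃ S : MeasSets M, BoolQuot.mk I S = E q := fun q => Quotient.exists_rep _
  choose G hG using hrep
  -- The case `b < a` is not excluded (the quotient is then trivial). As `b ≤ q` is tested first, a
  -- nonempty set may occur at any `q ≥ b`, hence the lower bound `min a b`.
  refine ⟨fun q => if b ≤ q then ⊤ else if (q : ℝ) < a then ⊥ else G q, min a b, b, ?_, ?_, ?_⟩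
  · intro q
    dsimp only
    split_ifs with h1 h2
    · exact (hb q h1).symm
    · exact (ha q h2).symm
    · exact hG q
  · intro q x hx
    dsimp only at hx
    split_ifs at hx with h1 h2
    · exact (min_le_right a b).trans h1
    · exact absurd hx (Set.notMem_empty x)
    · exact (min_le_left a b).trans (not_lt.1 h2)
  · intro q hq x
    dsimp only
    rw [if_pos hq]
    exact Set.mem_univ x

/-- Measurable sets indexed by the rationals, empty far to the left and everything far to the right,
are separated by the bounded measurable function `x ↦ inf {q | x ∈ F q}`. -/
theorem exists_boundedMeasurable_lt_iff (F : ℚ → MeasSets M) (a b : ℝ)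
    (ha : ∀ q : ℚ, ∀ x ∈ (F q : Set M), a ≤ q) (hb : ∀ q : ℚ, b ≤ q → ∀ x, x ∈ (F q : Set M)) :
    ∃ φ : boundedMeasurable M, ∀ x (t : ℝ),
      (φ : M → ℝ) x < t ↔ ∃ q : ℚ, (q : ℝ) < t ∧ x ∈ (F q : Set M) := by
  -- This one rational lies in every `s x`: it makes the infima meaningful and bounds them all
  -- above.
  obtain ⟨p, hp⟩ := exists_rat_gt b
  let s : M → Set ℝ := fun x => {r | ∃ q : ℚ, x ∈ (F q : Set M) ∧ (q : ℝ) = r}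
  have hbdd : ∀ x, a ∈ lowerBounds (s x) := by
    rintro x _ ⟨q, hq, rfl⟩
    exact ha q x hq
  have hps : ∀ x, (p : ℝ) ∈ s x := fun x => ⟨p, hb p hp.le x, rfl⟩
  have hlt : ∀ x (t : ℝ), sInf (s x) < t ↔ ∃ q : ℚ, (q : ℝ) < t ∧ x ∈ (F q : Set M) := by
    intro x t
    rw [csInf_lt_iff ⟨a, hbdd x⟩ ⟨p, hps x⟩]
    constructor
    · rintro ⟨_, ⟨q, hq, rfl⟩, hqt⟩
      exact ⟨q, hqt, hq⟩
    · rintro ⟨q, hqt, hq⟩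
      exact ⟨q, ⟨q, hq, rfl⟩, hqt⟩
  have hmeas : Measurable fun x => sInf (s x) := by
    refine measurable_of_Iio fun t => ?_
    have : (fun x => sInf (s x)) ⁻¹' Set.Iio t =
        ⋃ q : ℚ, ⋃ _ : (q : ℝ) < t, (F q : Set M) := by
      ext x
      simp only [Set.mem_preimage, Set.mem_Iio, hlt, Set.mem_iUnion, exists_prop]
    rw [this]
    exact MeasurableSet.iUnion fun q => MeasurableSet.iUnion fun _ => (F q).2
  refine ⟨⟨fun x => sInf (s x), hmeas, max |a| |(p : ℝ)|, fun x => ?_⟩, hlt⟩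
  exact abs_le_max_abs_abs (le_csInf ⟨p, hps x⟩ (hbdd x)) (csInf_le ⟨a, hbdd x⟩ (hps x))

/-- Every bounded spectral family in the quotient by a σ-ideal is induced by a bounded measurable
function. -/
theorem IsBoundedSpectralFamily.exists_eq_mk_specFamily (hI : IsSigmaIdeal I)
    {E : ℝ → BoolQuot I} (hE : IsBoundedSpectralFamily E) :
    ∃ φ : boundedMeasurable M, ∀ t, E t = BoolQuot.mk I (specFamily φ t) := by
  obtain ⟨F, a, b, hF, ha, hb⟩ := hE.exists_representatives
  obtain ⟨φ, hφ⟩ := exists_boundedMeasurable_lt_iff F a b ha hb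
  -- The second inequality is the only use of right continuity: it suffices to lie below `E u` for
  -- every `u > t`.
  refine ⟨φ, fun t => le_antisymm ?_ ((hE.1.isGLB_Ioi t).2 ?_)⟩
  · obtain ⟨S, hS⟩ : ∃ S, BoolQuot.mk I S = E t := Quotient.exists_rep _
    rw [← hS]
    -- These sets cover `S \ {φ ≤ t}`: if `t < r < φ x`, then `x ∉ F r`.
    have hmem : ∀ q : {q : ℚ // t < q}, S \ F q ∈ I := fun q =>
      BoolQuot.mk_le_mk.1 (by rw [hS, hF]; exact hE.1.mono _ _ q.2.le)
    have : Nonempty {q : ℚ // t < q} := nonempty_subtype.2 (exists_rat_gt t)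
    refine BoolQuot.mk_le_mk.2 (hI.mem_of_subset_iUnion hmem ?_)
    rintro x ⟨hxS, hx⟩
    obtain ⟨q, htq, hqx⟩ := exists_rat_btwn (not_le.1 (show ¬ (φ : M → ℝ) x ≤ t from hx))
    obtain ⟨r, htr, hrq⟩ := exists_rat_btwn htq
    exact Set.mem_iUnion.2 ⟨⟨r, htr⟩, hxS, fun h =>
      lt_asymm hqx ((hφ x q).2 ⟨r, hrq, h⟩)⟩
  · rintro _ ⟨u, hu, rfl⟩
    obtain ⟨S, hS⟩ : ∃ S, BoolQuot.mk I S = E u := Quotient.exists_rep _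
    rw [← hS]
    -- These cover `{φ ≤ t} \ S`: `φ x ≤ t < u` puts `x` in some `F q` with `q < u`.
    have hmem : ∀ q : {q : ℚ // (q : ℝ) < u}, F q \ S ∈ I := fun q =>
      BoolQuot.mk_le_mk.1 (by rw [hS, hF]; exact hE.1.mono _ _ q.2.le)
    have : Nonempty {q : ℚ // (q : ℝ) < u} := nonempty_subtype.2 (exists_rat_lt u)
    refine BoolQuot.mk_le_mk.2 (hI.mem_of_subset_iUnion hmem ?_)
    rintro x ⟨hx, hxS⟩
    obtain ⟨q, hqu, hq⟩ := (hφ x u).1 (lt_of_le_of_lt (show (φ : M → ℝ) x ≤ t from hx) hu)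
    exact Set.mem_iUnion.2 ⟨⟨q, hqu⟩, hq, hxS⟩

end Representation

theorem mainTheorem3 {M : Type*} [MeasurableSpace M] (I : Order.Ideal (MeasSets M))
    (hI : IsSigmaIdeal I) (E : ℝ → BoolQuot I) (hE : IsBoundedSpectralFamily E) :
    ∃ φ : boundedMeasurable M,
      (∀ t : ℝ, E t = BoolQuot.mk I (specFamily φ t)) ∧
      ∀ ψ : boundedMeasurable M,
        (∀ t : ℝ, E t = BoolQuot.mk I (specFamily ψ t)) ↔ ψ - φ ∈ vanishingIdeal I := by
  obtain ⟨φ, hφ⟩ := hE.exists_eq_mk_specFamily hI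
  refine ⟨φ, hφ, fun ψ => ?_⟩
  simp only [hφ]
  exact mk_specFamily_eq_iff hI φ ψ
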